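/- Let $p$ be a prime and let $K$ be a field of characteristic $0$, complete for a nonarchimedean absolute value with $|p|=p^{-1}$; fix an algebraic closure $K^{\mathrm{alg}}$. For $k\ge 1$ let $\Gamma_k$ be the group of $p^k$-th roots of unity in $K^{\mathrm{alg}}$, $\Gamma=\bigcup_k\Gamma_k$, and give $K(\Gamma)$ the unique absolute value extending that of $K$. Let $n\ge 0$ and $\rho\in\mathbb{R}_{>0}^n$. For $\alpha,\beta\in\mathbb{R}_{>0}^n$ with $\alpha_i<\rho_i<\beta_i$ for all $i$, put $J=[\alpha,\beta]=\prod_i[\alpha_i,\beta_i]$ and let $K_{J,n}$ be the ring of Laurent series $f=\sum_{i\in\mathbb{Z}^n}f_it^i$ over $K$ with $|f_i|\sigma^i\to 0$ for every $\sigma\in J$; for $f\in K_{J,n}$, or $f\in K_{J,n}\otimes_KK(\Gamma)$ viewed as a Laurent series over $K(\Gamma)$, put $|f|_J=\sup_{\sigma\in J}\sup_i|f_i|\sigma^i$, and let the norm $|\cdot|_J$ of a matrix be the maximum of the norms of its entries. Let $R_\rho=\varinjlim_J K_{J,n}=\bigcup_JK_{J,n}$. The group $\Gamma^n$ acts on $K_{J,n}\otimes_KK(\Gamma)$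 and on $R_\rho\otimes_KK(\Gamma)$ by $\zeta^*(f(t))=f(\zeta t)$. An object of $\mathscr{C}_\rho$ is a finite free $R_\rho$-module $P$ with a semilinear action $\zeta\mapsto\zeta^*$ of the group $\Gamma^n$ on $P\otimes_KK(\Gamma)$ such that: (a) for some $J=[\alpha,\beta]$ as above, $P$ with its action is induced by extension of scalars from a finite free $K_{J,n}$-module $P'$ with a semilinear action of $\Gamma^n$ on $P'\otimes_KK(\Gamma)$, and for some basis of $P'$ there is $l>0$ such that for all $k\ge1$ and $\zeta\in\Gamma_k^n$ the matrix $E(\zeta)$ of $\zeta^*$ in this basis satisfies $|E(\zeta)|_J\le p^{lk}$ (we say that $P$ is defined by $P'$ over $J$); (b) $\tau(\zeta^*(x))=\tau(\zeta)^*(\tau(x))$ for all $\tau\in\mathrm{Gal}(K(\Gamma)/K)$, $\zeta\in\Gamma^n$ and $x\in P\otimes_KK(\Gamma)$. Let $P$ be an object of $\mathscr{C}_\rho$ of rank $m$, defined by $P'$ over $J=[\alpha,\beta]$, and let $e_1,\dots,e_m$ be a basis of $P'$. An exponent of $P$ (admitted by $P'$, with respect to this basis) is an $n$-tuple $A=(A^1,\dots,A^n)$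 of diagonal $m\times m$ matrices over $\mathbb{Z}_p$ for which there are matrices $S_{k,A}\in \mathrm{M}_m(K_{J,n})$, $k\ge 1$, such that: (1) putting $(v_{k,1},\dots,v_{k,m})=(e_1,\dots,e_m)S_{k,A}$, one has $\zeta^*(v_{k,1},\dots,v_{k,m})=(v_{k,1},\dots,v_{k,m})\,\zeta^A$ for all $k\ge1$ and $\zeta\in\Gamma_k^n$, where $\zeta^A=\prod_{r=1}^n\zeta_r^{A^r}$ is the diagonal matrix with $j$-th entry $\prod_r\zeta_r^{A^r_{jj}}$; (2) there is $l>0$ with $|S_{k,A}|_J\le p^{lk}$ for all $k\ge1$; (3) $|\det S_{k,A}|_J\ge 1$ for all $k\ge1$. **Theorem.** Every object $P$ of $\mathscr{C}_\rho$ has an exponent. More precisely, for every $J$ and every $P'$ by which $P$ is defined over $J$, there is an $n$-tuple $A$ of diagonal matrices over $\mathbb{Z}_p$ which is an exponent of $P$ admitted by $P'$, with respect to every basis of $P'$. -/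

import Mathlib

noncomputable section

open Filter Topology TensorProduct

set_option linter.unusedSectionVars false

namespace PAdicFuchs

universe u v

/-! ### Laurent series converging on polyannuli -/

/-- The space `ℝ_{>0}^n` of polyradii. -/
abbrev Radii (n : ℕ) : Type := Fin n → Set.Ioi (0 : ℝ)

/-- The monomial value `σ^i = σ_1^{i_1} ⋯ σ_n^{i_n}`. -/
def wt {n : ℕ} (σ : Radii n) (i : Fin n → ℤ) : ℝ := ∏ j, (σ j : ℝ) ^ (i j)

theorem wt_pos {n : ℕ} (σ : Radii n) (i : Fin n → ℤ) : 0 < wt σ i :=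
  Finset.prod_pos fun j _ => zpow_pos (σ j).2 _

theorem wt_add {n : ℕ} (σ : Radii n) (i j : Fin n → ℤ) : wt σ (i + j) = wt σ i * wt σ j := by
  simp only [wt, Pi.add_apply, ← Finset.prod_mul_distrib]
  exact Finset.prod_congr rfl fun a _ => zpow_add₀ (ne_of_gt (σ a).2) _ _

/-- A formal Laurent series `∑ f_i t^i` satisfies `|f_i| σ^i → 0` as `|i| → ∞`. -/
def Decays {K : Type u} [NontriviallyNormedField K] {n : ℕ} (f : (Fin n → ℤ) → K) (σ : Radii n) :
    Prop :=
  Tendsto (fun i => ‖f i‖ * wt σ i) cofinite (𝓝 0)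

/-- The Cauchy product of two formal Laurent series. -/
def conv {K : Type u} [NontriviallyNormedField K] {n : ℕ} (f g : (Fin n → ℤ) → K) :
    (Fin n → ℤ) → K :=
  fun k => ∑' i, f i * g (k - i)

section Convolution

variable {K : Type u} [NontriviallyNormedField K] {n : ℕ} {σ : Radii n}
  {f g h : (Fin n → ℤ) → K}

theorem Decays.zero : Decays (0 : (Fin n → ℤ) → K) σ := by
  refine tendsto_const_nhds.congr fun i => ?_
  simp

theorem Decays.add (hf : Decays f σ) (hg : Decays g σ) : Decays (f + g) σ := by
  have := Tendsto.add hf hg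
  rw [add_zero] at this
  refine squeeze_zero (fun i => mul_nonneg (norm_nonneg _) (wt_pos σ i).le) (fun i => ?_) this
  rw [← add_mul]
  exact mul_le_mul_of_nonneg_right (norm_add_le _ _) (wt_pos σ i).le

theorem Decays.smul (c : K) (hf : Decays f σ) : Decays (c • f) σ := by
  have := Tendsto.const_mul ‖c‖ hf
  rw [mul_zero] at this
  refine this.congr fun i => ?_
  simp [mul_assoc]

theorem Decays.bound (hf : Decays f σ) : ∃ C, ∀ i, ‖f i‖ * wt σ i ≤ C := by
  obtain ⟨C, hC⟩ := hf.bddAbove_range_of_cofinite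
  exact ⟨C, fun i => hC ⟨i, rfl⟩⟩

theorem Decays.single (i₀ : Fin n → ℤ) (c : K) : Decays (Pi.single i₀ c) σ := by
  refine tendsto_const_nhds.congr' ?_
  rw [EventuallyEq, eventually_cofinite]
  refine (Set.finite_singleton i₀).subset fun i hi => ?_
  by_contra hne
  exact hi (by simp [Pi.single_eq_of_ne (show i ≠ i₀ from hne)])

theorem Decays.prod_tendsto (hf : Decays f σ) (hg : Decays g σ) :
    Tendsto (fun q : (Fin n → ℤ) × (Fin n → ℤ) => ‖f q.1 * g q.2‖ * wt σ (q.1 + q.2))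
      cofinite (𝓝 0) := by
  refine (tendsto_mul_cofinite_nhds_zero hf hg).congr fun q => ?_
  rw [wt_add, norm_mul]; ring

variable [CompleteSpace K] [IsUltrametricDist K]

theorem Decays.summable (hf : Decays f σ) (hg : Decays g σ) (k : Fin n → ℤ) :
    Summable fun i => f i * g (k - i) := by
  apply NonarchimedeanAddGroup.summable_of_tendsto_cofinite_zero
  rw [tendsto_zero_iff_norm_tendsto_zero]
  have hinj : Function.Injective fun i : Fin n → ℤ => (i, k - i) := fun a b hab =>
    (Prod.ext_iff.1 hab).1
  have := ((hf.prod_tendsto hg).comp hinj.tendsto_cofinite).mul_const (wt σ k)⁻¹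
  rw [zero_mul] at this
  refine this.congr fun i => ?_
  simp [mul_assoc, (wt_pos σ k).ne']

theorem norm_tsum_le {ι : Type*} {a : ι → K} (ha : Summable a) {C : ℝ} (hC : 0 ≤ C)
    (h : ∀ i, ‖a i‖ ≤ C) : ‖∑' i, a i‖ ≤ C :=
  le_of_tendsto ha.hasSum.norm <| Eventually.of_forall fun _ =>
    IsUltrametricDist.norm_sum_le_of_forall_le_of_nonneg hC fun i _ => h i

theorem Decays.conv (hf : Decays f σ) (hg : Decays g σ) : Decays (conv f g) σ := by
  rw [Decays, Metric.tendsto_nhds]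
  intro ε hε
  have h := Metric.tendsto_nhds.1 (hf.prod_tendsto hg) (ε / 2) (half_pos hε)
  rw [eventually_cofinite] at h ⊢
  refine (h.image fun q => q.1 + q.2).subset fun k hk => ?_
  by_contra hcon
  apply hk
  have hle : ‖PAdicFuchs.conv f g k‖ ≤ ε / 2 * (wt σ k)⁻¹ := by
    refine norm_tsum_le (hf.summable hg k)
      (mul_nonneg (half_pos hε).le (inv_nonneg.2 (wt_pos σ k).le)) fun i => ?_
    have h1 : ¬ ¬ dist (‖f i * g (k - i)‖ * wt σ (i + (k - i))) 0 < ε / 2 := fun h1 =>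
      hcon ⟨(i, k - i), h1, by simp⟩
    rw [not_not, add_sub_cancel, Real.dist_0_eq_abs] at h1
    rw [← div_eq_mul_inv, le_div_iff₀ (wt_pos σ k)]
    exact (le_abs_self _).trans h1.le
  rw [Real.dist_0_eq_abs, abs_of_nonneg (mul_nonneg (norm_nonneg _) (wt_pos σ k).le)]
  rw [← div_eq_mul_inv, le_div_iff₀ (wt_pos σ k)] at hle
  linarith

theorem conv_comm (f g : (Fin n → ℤ) → K) : conv f g = conv g f := by
  funext k
  simp only [conv]
  rw [← (Equiv.subLeft k).tsum_eq]
  exact tsum_congr fun i => by simp [mul_comm]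

theorem one_conv (f : (Fin n → ℤ) → K) : conv (Pi.single 0 1) f = f := by
  funext k
  simp only [conv]
  rw [tsum_eq_single 0 fun i hi => by simp [Pi.single_eq_of_ne hi]]
  simp

theorem conv_add (hf : Decays f σ) (hg : Decays g σ) (hh : Decays h σ) :
    conv f (g + h) = conv f g + conv f h := by
  funext k
  simp only [conv, Pi.add_apply, mul_add]
  exact (hf.summable hg k).tsum_add (hf.summable hh k)

theorem smul_conv (c : K) (f g : (Fin n → ℤ) → K) : conv (c • f) g = c • conv f g := by
  funext k
  simp only [conv, Pi.smul_apply, smul_eq_mul, mul_assoc]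
  exact tsum_mul_left

theorem conv_assoc (hf : Decays f σ) (hg : Decays g σ) (hh : Decays h σ) :
    conv (conv f g) h = conv f (conv g h) := by
  funext k
  have hs : Summable (Function.uncurry fun (s i : Fin n → ℤ) => f i * g (s - i) * h (k - s)) := by
    apply NonarchimedeanAddGroup.summable_of_tendsto_cofinite_zero
    rw [tendsto_zero_iff_norm_tendsto_zero]
    have hinj : Function.Injective fun q : (Fin n → ℤ) × (Fin n → ℤ) => (q.2, q.1 - q.2) := by
      rintro ⟨a, b⟩ ⟨c, d⟩ hab
      simp only [Prod.mk.injEq] at hab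
      obtain ⟨rfl, h2⟩ := hab
      simpa using h2
    obtain ⟨C, hC⟩ := hh.bound
    have := ((hf.prod_tendsto hg).comp hinj.tendsto_cofinite).mul_const (C * (wt σ k)⁻¹)
    rw [zero_mul] at this
    refine squeeze_zero (fun _ => norm_nonneg _) (fun q => ?_) this
    obtain ⟨s, i⟩ := q
    simp only [Function.uncurry, Function.comp, add_sub_cancel]
    rw [norm_mul, mul_assoc, ← div_eq_mul_inv]
    refine mul_le_mul_of_nonneg_left ?_ (norm_nonneg _)
    rw [← mul_div_assoc, le_div_iff₀ (wt_pos σ k)]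
    have h2 : wt σ k = wt σ (k - s) * wt σ s := by rw [← wt_add, sub_add_cancel]
    rw [h2, ← mul_assoc, mul_comm (wt σ s)]
    exact mul_le_mul_of_nonneg_right (hC _) (wt_pos σ s).le
  calc PAdicFuchs.conv (PAdicFuchs.conv f g) h k
      = ∑' s, ∑' i, f i * g (s - i) * h (k - s) := by
        simp only [PAdicFuchs.conv]
        exact tsum_congr fun s => tsum_mul_right.symm
    _ = ∑' i, ∑' s, f i * g (s - i) * h (k - s) := hs.tsum_comm.symm
    _ = PAdicFuchs.conv f (PAdicFuchs.conv g h) k := by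
        simp only [PAdicFuchs.conv]
        refine tsum_congr fun i => ?_
        rw [← tsum_mul_left, ← (Equiv.addLeft i).tsum_eq]
        exact tsum_congr fun j => by
          simp only [Equiv.coe_addLeft, add_sub_cancel_left, sub_add_eq_sub_sub]
          ring

end Convolution

/-- Laurent series which converge at all polyradii in some member of the filter `F`. -/
def laurentSubmodule (K : Type u) [NontriviallyNormedField K] {n : ℕ} (F : Filter (Radii n)) :
    Submodule K ((Fin n → ℤ) → K) where
  carrier := {f | ∀ᶠ σ in F, Decays f σ}
  add_mem' hf hg := by
    filter_upwards [hf, hg] with σ h1 h2 using h1.add h2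
  zero_mem' := Eventually.of_forall fun _ => Decays.zero
  smul_mem' c f hf := by
    filter_upwards [hf] with σ h1 using h1.smul c

/-- The ring of Laurent series converging at all polyradii in some member of the filter `F`.
For `F = 𝓟 I` this is the ring `K_{I,n}` of functions on the polyannulus with radii in `I`;
for `F = 𝓝 ρ` it is the ring `R_ρ` (see `mem_laurentSubmodule_nhds`). -/
def Laurent (K : Type u) [NontriviallyNormedField K] {n : ℕ} (F : Filter (Radii n)) : Type u :=
  ↥(laurentSubmodule K F)

namespace Laurent

section Ring

variable {K : Type u} [NontriviallyNormedField K] {n : ℕ} {F G : Filter (Radii n)}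

/-- The additive group structure (not an instance: the one below the ring structure is used). -/
abbrev addGroupAux : AddCommGroup (Laurent K F) :=
  inferInstanceAs (AddCommGroup ↥(laurentSubmodule K F))

theorem ext_val {f g : Laurent K F} (h : f.1 = g.1) : f = g := Subtype.ext h

variable [CompleteSpace K] [IsUltrametricDist K]

variable [F.NeBot] [G.NeBot]

theorem exists_decays (f g h : Laurent K F) :
    ∃ σ, Decays f.1 σ ∧ Decays g.1 σ ∧ Decays h.1 σ :=
  (Eventually.and f.2 (Eventually.and g.2 h.2)).exists

instance : CommRing (Laurent K F) :=
  { (addGroupAux : AddCommGroup (Laurent K F)) with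
    mul := fun f g =>
      ⟨conv f.1 g.1, by filter_upwards [f.2, g.2] with σ h1 h2 using h1.conv h2⟩
    one := ⟨Pi.single 0 1, Eventually.of_forall fun _ => Decays.single 0 1⟩
    mul_assoc := fun f g h => by
      obtain ⟨σ, h1, h2, h3⟩ := exists_decays f g h
      exact ext_val (conv_assoc h1 h2 h3)
    mul_comm := fun f g => ext_val (conv_comm _ _)
    one_mul := fun f => ext_val (one_conv _)
    mul_one := fun f => ext_val ((conv_comm _ _).trans (one_conv _))
    left_distrib := fun f g h => by
      obtain ⟨σ, h1, h2, h3⟩ := exists_decays f g h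
      exact ext_val (conv_add h1 h2 h3)
    right_distrib := fun f g h => by
      obtain ⟨σ, h1, h2, h3⟩ := exists_decays f g h
      refine ext_val ?_
      change conv (f.1 + g.1) h.1 = conv f.1 h.1 + conv g.1 h.1
      rw [conv_comm, conv_add h3 h1 h2, conv_comm, conv_comm h.1]
    zero_mul := fun f => ext_val (by
      funext k
      change ∑' i, (0 : K) * _ = 0
      simp)
    mul_zero := fun f => ext_val (by
      funext k
      change ∑' i, _ * (0 : K) = 0
      simp) }

/-- The `K`-module structure (not an instance: the one below the algebra structure is used). -/
abbrev moduleAux : Module K (Laurent K F) :=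
  inferInstanceAs (Module K ↥(laurentSubmodule K F))

instance : Algebra K (Laurent K F) :=
  letI : Module K (Laurent K F) := moduleAux
  Algebra.ofModule (fun c f g => ext_val (smul_conv c _ _))
    (fun c f g => ext_val (by
      change conv f.1 (c • g.1) = c • conv f.1 g.1
      rw [conv_comm, smul_conv, conv_comm]))

/-- The linear map sending a Laurent series to its family of coefficients. -/
def coeffs : Laurent K F →ₗ[K] ((Fin n → ℤ) → K) where
  toFun f := f.1
  map_add' _ _ := rfl
  map_smul' _ _ := rfl

theorem coeffs_decays (f : Laurent K F) : ∀ᶠ σ in F, Decays (coeffs f) σ := f.2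

theorem ext_coeffs {f g : Laurent K F} (h : coeffs f = coeffs g) : f = g := Subtype.ext h

theorem coeffs_mul (f g : Laurent K F) : coeffs (f * g) = conv (coeffs f) (coeffs g) := rfl

theorem coeffs_one : coeffs (1 : Laurent K F) = Pi.single 0 1 := rfl

/-- The inclusion of rings of Laurent series when the domain shrinks. -/
def incl (h : F ≤ G) : Laurent K G →ₐ[K] Laurent K F :=
  AlgHom.ofLinearMap
    { toFun := fun f => ⟨coeffs f, h f.2⟩
      map_add' := fun _ _ => rfl
      map_smul' := fun _ _ => rfl }
    rfl (fun _ _ => rfl)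

/-- The part of a Laurent series supported on the exponents in `T`. -/
def restrict (T : Set (Fin n → ℤ)) : Laurent K F →ₗ[K] Laurent K F where
  toFun f := ⟨T.indicator (coeffs f), by
    filter_upwards [f.2] with σ h
    refine squeeze_zero (fun i => mul_nonneg (norm_nonneg _) (wt_pos σ i).le) (fun i => ?_) h
    exact mul_le_mul_of_nonneg_right (norm_indicator_le_norm_self _ _) (wt_pos σ i).le⟩
  map_add' f g := ext_coeffs (Set.indicator_add T _ _)
  map_smul' c f := ext_coeffs (Set.indicator_const_smul T c _)

end Ring

end Laurent

/-- A closed polysegment `[α, β]` of `ℝ_{>0}^n` containing `ρ` in its interior. -/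
structure Polysegment {n : ℕ} (ρ : Radii n) where
  lo : Radii n
  hi : Radii n
  lo_lt : ∀ i, lo i < ρ i
  lt_hi : ∀ i, ρ i < hi i

namespace Polysegment

variable {n : ℕ} {ρ : Radii n}

/-- The underlying set `∏ [α_i, β_i]`. -/
def toSet (J : Polysegment ρ) : Set (Radii n) := Set.Icc J.lo J.hi

theorem mem_toSet (J : Polysegment ρ) : ρ ∈ J.toSet :=
  ⟨fun i => (J.lo_lt i).le, fun i => (J.lt_hi i).le⟩

instance (J : Polysegment ρ) : (𝓟 J.toSet).NeBot := principal_neBot_iff.2 ⟨ρ, J.mem_toSet⟩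

theorem nhds_le (J : Polysegment ρ) : 𝓝 ρ ≤ 𝓟 J.toSet := by
  rw [le_principal_iff, toSet, ← Set.pi_univ_Icc]
  exact set_pi_mem_nhds Set.finite_univ fun i _ => Icc_mem_nhds (J.lo_lt i) (J.lt_hi i)

end Polysegment

/-- `R_ρ` is the directed union of the rings `K_{J,n}`. -/
theorem mem_laurentSubmodule_nhds {K : Type u} [NontriviallyNormedField K] {n : ℕ} {ρ : Radii n}
    {f : (Fin n → ℤ) → K} :
    f ∈ laurentSubmodule K (𝓝 ρ) ↔ ∃ J : Polysegment ρ, f ∈ laurentSubmodule K (𝓟 J.toSet) := by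
  refine ⟨fun h => ?_, fun ⟨J, h⟩ => J.nhds_le h⟩
  have h' : {σ | Decays f σ} ∈ 𝓝 ρ := h
  rw [nhds_pi, mem_pi] at h'
  obtain ⟨I, -, t, ht, hsub⟩ := h'
  have key : ∀ i, ∃ a b : Set.Ioi (0 : ℝ), a < ρ i ∧ ρ i < b ∧ Set.Icc a b ⊆ t i := by
    intro i
    obtain ⟨b', hb'⟩ := exists_gt (ρ i)
    obtain ⟨a', ha'⟩ := exists_lt (ρ i)
    obtain ⟨a, b, hab, hs⟩ := (mem_nhds_iff_exists_Ioo_subset' ⟨a', ha'⟩ ⟨b', hb'⟩).1 (ht i)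
    obtain ⟨a₁, h1, h2⟩ := exists_between hab.1
    obtain ⟨b₁, h3, h4⟩ := exists_between hab.2
    exact ⟨a₁, b₁, h2, h3, fun x hx => hs ⟨h1.trans_le hx.1, hx.2.trans_lt h4⟩⟩
  choose a b ha hb hab using key
  refine ⟨⟨a, b, ha, hb⟩, fun σ hσ => hsub fun i _ => hab i ⟨hσ.1 i, hσ.2 i⟩⟩

/-- The ring `R_ρ` of germs of Laurent series. -/
abbrev GermRing (K : Type u) [NontriviallyNormedField K] {n : ℕ} (ρ : Radii n) : Type u :=
  Laurent K (𝓝 ρ)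

/-- The ring `K_{[α,β],n}`. -/
abbrev SegRing (K : Type u) [NontriviallyNormedField K] {n : ℕ} {ρ : Radii n}
    (J : Polysegment ρ) : Type u :=
  Laurent K (𝓟 J.toSet)

instance {K : Type u} [NontriviallyNormedField K] [CompleteSpace K] [IsUltrametricDist K] {n : ℕ}
    {ρ : Radii n} (J : Polysegment ρ) : Algebra (SegRing K J) (GermRing K ρ) :=
  (Laurent.incl J.nhds_le).toRingHom.toAlgebra

instance {K : Type u} [NontriviallyNormedField K] [CompleteSpace K] [IsUltrametricDist K] {n : ℕ}
    {ρ : Radii n} (J : Polysegment ρ) : IsScalarTower K (SegRing K J) (GermRing K ρ) :=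
  IsScalarTower.of_algebraMap_eq fun c => ((Laurent.incl J.nhds_le).commutes c).symm

/-! ### Roots of unity -/

/-- The field `K(Γ)` generated over `K` by the roots of unity of `p`-power order in `K^alg`. -/
abbrev KGam (K : Type u) [Field K] (p : ℕ) : IntermediateField K (AlgebraicClosure K) :=
  IntermediateField.adjoin K {x | ∃ s : ℕ, x ^ p ^ s = 1}

/-- The group `Γ` of roots of unity of `p`-power order. -/
def Gam (K : Type u) [Field K] (p : ℕ) : Subgroup (KGam K p)ˣ where
  carrier := {x | ∃ s : ℕ, x ^ p ^ s = 1}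
  one_mem' := ⟨0, one_pow _⟩
  mul_mem' := by
    rintro x y ⟨s, hs⟩ ⟨r, hr⟩
    refine ⟨s + r, ?_⟩
    rw [mul_pow, pow_add, pow_mul, hs, one_pow, one_mul, mul_comm, pow_mul, hr, one_pow]
  inv_mem' := by
    rintro x ⟨s, hs⟩
    exact ⟨s, by rw [inv_pow, hs, inv_one]⟩

namespace Gam

variable {K : Type u} [Field K] {p : ℕ}

/-- An element of `Γ` seen in `K(Γ)`. -/
def val (z : Gam K p) : KGam K p := ((z : (KGam K p)ˣ) : KGam K p)

/-- The Galois action on `Γ`. -/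
def gal (τ : KGam K p ≃ₐ[K] KGam K p) (z : Gam K p) : Gam K p :=
  ⟨Units.map (τ : KGam K p →* KGam K p) z, by
    obtain ⟨s, hs⟩ := z.2
    exact ⟨s, by rw [← map_pow, hs, map_one]⟩⟩

open Classical in
/-- The power `z^a` of `z ∈ Γ` with exponent a `p`-adic integer: if `z^{p^s} = 1`, then `z^a` is
`z^b` for any integer `b ≡ a` modulo `p^s`. -/
def padicPow [Fact p.Prime] (z : Gam K p) (a : ℤ_[p]) : Gam K p :=
  z ^ (PadicInt.toZModPow (Nat.find z.2) a).val

/-- The character `i ↦ ζ^i = ζ_1^{i_1} ⋯ ζ_n^{i_n}` of `ℤ^n` given by `ζ ∈ Γ^n`. -/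
def char {n : ℕ} (ζ : Fin n → Gam K p) (i : Fin n → ℤ) : KGam K p := val (∏ j, ζ j ^ i j)

theorem finite_range_char [Fact p.Prime] {n : ℕ} (ζ : Fin n → Gam K p) :
    (Set.range (char ζ)).Finite := by
  choose s hs using fun j => (ζ j).2
  have hle : ∀ j, s j ≤ ∑ j, s j := fun j => Finset.single_le_sum (by simp) (Finset.mem_univ j)
  have hpos : 0 < p ^ ∑ j, s j := pow_pos (Fact.out : p.Prime).pos _
  refine (Polynomial.nthRootsFinset (p ^ ∑ j, s j) (1 : KGam K p)).finite_toSet.subset ?_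
  rintro _ ⟨i, rfl⟩
  rw [Finset.mem_coe, Polynomial.mem_nthRootsFinset hpos]
  have h1 : ∀ j, ζ j ^ p ^ (∑ j, s j) = 1 := fun j => by
    apply Subtype.ext
    rw [← Nat.sub_add_cancel (hle j), pow_add, mul_comm, pow_mul]
    simp only [Subgroup.coe_pow, Subgroup.coe_one]
    rw [hs, one_pow]
  have h2 : (∏ j, ζ j ^ i j) ^ p ^ (∑ j, s j) = 1 := by
    rw [← Finset.prod_pow]
    refine Finset.prod_eq_one fun j _ => ?_
    rw [← zpow_natCast, ← zpow_mul, mul_comm, zpow_mul, zpow_natCast, h1, one_zpow]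
  have h3 := congrArg val h2
  simpa [char, val] using h3

end Gam

/-! ### Extension of scalars to `K(Γ)` -/

section Scalars

variable {K : Type u} [NontriviallyNormedField K] [CompleteSpace K] [IsUltrametricDist K]
  {p : ℕ} {n : ℕ} {F : Filter (Radii n)} [F.NeBot]

/-- The `i`-th coefficient of an element of `Laurent K F ⊗ K(Γ)`, seen as a Laurent series
over `K(Γ)`. -/
def coeffGam (i : Fin n → ℤ) : Laurent K F ⊗[K] KGam K p →ₗ[K] KGam K p :=
  TensorProduct.lift ((LinearMap.lsmul K (KGam K p)).comp
    ((LinearMap.proj i).comp Laurent.coeffs))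

/-- The action `ζ^*(f(t)) = f(ζ t)` of `ζ ∈ Γ^n` on `Laurent K F ⊗ K(Γ)`: it sends
`f ⊗ a` to `∑_c f_c ⊗ c a`, where `c` runs over the finitely many values of `ζ^i` and `f_c` is the
part of `f` with exponents `i` such that `ζ^i = c` (see `coeffGam_twist`). -/
def twist [Fact p.Prime] (ζ : Fin n → Gam K p) :
    Laurent K F ⊗[K] KGam K p →ₗ[K] Laurent K F ⊗[K] KGam K p :=
  ∑ c ∈ (Gam.finite_range_char ζ).toFinset,
    TensorProduct.map (Laurent.restrict {i | Gam.char ζ i = c}) (LinearMap.mulLeft K c)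

theorem coeffGam_twist [Fact p.Prime] (ζ : Fin n → Gam K p) (i : Fin n → ℤ)
    (f : Laurent K F ⊗[K] KGam K p) :
    coeffGam i (twist ζ f) = Gam.char ζ i * coeffGam i f := by
  classical
  induction f with
  | zero => simp
  | add x y hx hy => rw [map_add, map_add, map_add, hx, hy, mul_add]
  | tmul g a =>
    have h1 : ∀ c : KGam K p, coeffGam i
        (TensorProduct.map (Laurent.restrict {i | Gam.char ζ i = c}) (LinearMap.mulLeft K c)
          (g ⊗ₜ[K] a)) = if Gam.char ζ i = c then Gam.char ζ i * coeffGam i (g ⊗ₜ[K] a) else 0 := by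
      intro c
      change (Set.indicator {i | Gam.char ζ i = c} (Laurent.coeffs g) i) • (c * a) =
        if Gam.char ζ i = c then Gam.char ζ i * (Laurent.coeffs g i • a) else 0
      rw [Set.indicator_apply]
      split_ifs with h h' h'
      · rw [← h', mul_smul_comm]
      · exact absurd h h'
      · exact absurd h' h
      · exact zero_smul _ _
    rw [twist, LinearMap.sum_apply, map_sum]
    simp only [h1]
    rw [Finset.sum_ite_eq, if_pos]
    simp

/-- The action of `Laurent K F ⊗ K(Γ)` on `M ⊗ K(Γ)`, `(f ⊗ a) • (x ⊗ b) = f x ⊗ a b`. -/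
def extSmul {M : Type v} [AddCommGroup M] [Module K M] [Module (Laurent K F) M]
    [IsScalarTower K (Laurent K F) M] :
    Laurent K F ⊗[K] KGam K p →ₗ[K] M ⊗[K] KGam K p →ₗ[K] M ⊗[K] KGam K p :=
  TensorProduct.map₂ (Algebra.lsmul K K M).toLinearMap (LinearMap.mul K (KGam K p))

/-- The supremum norm `|f|_J` of `f ∈ K_{J,n}`: the supremum over `σ ∈ J` of the `σ`-Gauss norms
`sup_i |f_i| σ^i`. -/
def segNorm {ρ : Radii n} {J : Polysegment ρ} (f : SegRing K J) : ℝ :=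
  ⨆ σ : J.toSet, ⨆ i : Fin n → ℤ, ‖Laurent.coeffs f i‖ * wt σ i

/-- The supremum norm `|f|_J` of `f ∈ K_{J,n} ⊗ K(Γ)`, where `K(Γ)` carries the unique norm
extending the one of `K`. -/
def segNormGam {ρ : Radii n} {J : Polysegment ρ} (f : SegRing K J ⊗[K] KGam K p) : ℝ :=
  ⨆ σ : J.toSet, ⨆ i : Fin n → ℤ, spectralNorm K (KGam K p) (coeffGam i f) * wt σ i

end Scalars

/-! ### The category `𝒞_ρ` -/

/-- A finite free module `M` over `Laurent K F` with a semilinear action of the group `Γ^n`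
on `M ⊗_K K(Γ)`. -/
structure GammaModule (K : Type u) [NontriviallyNormedField K] [CompleteSpace K]
    [IsUltrametricDist K] (p : ℕ) [Fact p.Prime] {n : ℕ} (F : Filter (Radii n)) [F.NeBot] where
  carrier : Type v
  [addCommGroup : AddCommGroup carrier]
  [moduleK : Module K carrier]
  [module : Module (Laurent K F) carrier]
  [tower : IsScalarTower K (Laurent K F) carrier]
  [finite : Module.Finite (Laurent K F) carrier]
  [free : Module.Free (Laurent K F) carrier]
  act : (Fin n → Gam K p) →* AddMonoid.End (carrier ⊗[K] KGam K p)
  semilinear : ∀ (ζ : Fin n → Gam K p) (f : Laurent K F ⊗[K] KGam K p)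
    (x : carrier ⊗[K] KGam K p), act ζ (extSmul f x) = extSmul (twist ζ f) (act ζ x)

attribute [instance] GammaModule.addCommGroup GammaModule.moduleK GammaModule.module
  GammaModule.tower GammaModule.finite GammaModule.free

section Category

variable {K : Type u} [NontriviallyNormedField K] [CompleteSpace K] [IsUltrametricDist K]
  {p : ℕ} [Fact p.Prime] {n : ℕ} {ρ : Radii n}

/-- The matrix `E` represents `ζ^*` in the basis `e`: `ζ^*(e_j ⊗ 1) = ∑_i E_{ij} (e_i ⊗ 1)`. -/
def Represents {F : Filter (Radii n)} [F.NeBot] (M : GammaModule.{u, v} K p F) {m : ℕ}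
    (e : Module.Basis (Fin m) (Laurent K F) M.carrier) (ζ : Fin n → Gam K p)
    (E : Matrix (Fin m) (Fin m) (Laurent K F ⊗[K] KGam K p)) : Prop :=
  ∀ j, M.act ζ (e j ⊗ₜ[K] 1) = ∑ i, extSmul (E i j) (e i ⊗ₜ[K] 1)

/-- The group `Γ_k^n`. -/
def GamLevel (K : Type u) [Field K] (p n k : ℕ) : Set (Fin n → Gam K p) :=
  {ζ | ∀ j, ζ j ^ p ^ k = 1}

/-- The `K`-linear map `P' → P` attached to an isomorphism `R_ρ ⊗ P' ≃ P`. -/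
def extMap {J : Polysegment ρ} {P' P : Type v} [AddCommGroup P'] [Module K P']
    [Module (SegRing K J) P'] [IsScalarTower K (SegRing K J) P'] [AddCommGroup P] [Module K P]
    [Module (GermRing K ρ) P] [IsScalarTower K (GermRing K ρ) P]
    (Φ : GermRing K ρ ⊗[SegRing K J] P' ≃ₗ[GermRing K ρ] P) : P' →ₗ[K] P where
  toFun x := Φ (1 ⊗ₜ x)
  map_add' x y := by rw [TensorProduct.tmul_add, map_add]
  map_smul' c x := by
    rw [RingHom.id_apply, ← algebraMap_smul (SegRing K J) c x, ← TensorProduct.smul_tmul,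
      ← algebraMap_smul (GermRing K ρ) c (Φ _), ← map_smul, TensorProduct.smul_tmul',
      IsScalarTower.algebraMap_apply K (SegRing K J) (GermRing K ρ), Algebra.smul_def,
      smul_eq_mul]

/-- A finite free `K_{J,n}`-module `P'`, with a semilinear action of `Γ^n` on `P' ⊗ K(Γ)`,
by which `P` is defined over `J`: `P` and its action are induced from `P'`, and
in some basis of `P'` the matrices of the elements of `Γ_k^n` have norm at most `p^{lk}`. -/
structure Model (P : GammaModule.{u, v} K p (𝓝 ρ)) where
  J : Polysegment ρ
  P' : GammaModule.{u, v} K p (𝓟 J.toSet)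
  iso : GermRing K ρ ⊗[SegRing K J] P'.carrier ≃ₗ[GermRing K ρ] P.carrier
  act_comm : ∀ (ζ : Fin n → Gam K p) (x : P'.carrier ⊗[K] KGam K p),
    P.act ζ (TensorProduct.map (extMap iso) LinearMap.id x) =
      TensorProduct.map (extMap iso) LinearMap.id (P'.act ζ x)
  bounded : ∃ (m : ℕ) (e : Module.Basis (Fin m) (SegRing K J) P'.carrier) (l : ℝ), 0 < l ∧
    ∀ k : ℕ, 0 < k → ∀ ζ ∈ GamLevel K p n k,
      ∃ E : Matrix (Fin m) (Fin m) (SegRing K J ⊗[K] KGam K p), Represents P' e ζ E ∧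
        ∀ i j, segNormGam (E i j) ≤ (p : ℝ) ^ (l * k)

variable (K p ρ) in
/-- The objects of the category `𝒞_ρ`. -/
structure Crho extends GammaModule.{u, v} K p (𝓝 ρ) where
  exists_model : Nonempty (Model toGammaModule)
  galois : ∀ (τ : KGam K p ≃ₐ[K] KGam K p) (ζ : Fin n → Gam K p) (x : carrier ⊗[K] KGam K p),
    TensorProduct.map LinearMap.id τ.toLinearMap (act ζ x) =
      act (fun j => Gam.gal τ (ζ j)) (TensorProduct.map LinearMap.id τ.toLinearMap x)

/-- The `n`-tuple `A` of diagonal matrices over `ℤ_p` is an exponent of `P`, admitted by the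
model `M` of `P`, with respect to the basis `e` of `M.P'`. -/
def Model.IsExponent {P : GammaModule.{u, v} K p (𝓝 ρ)} (M : Model P) {m : ℕ}
    (e : Module.Basis (Fin m) (SegRing K M.J) M.P'.carrier)
    (A : Fin n → Matrix (Fin m) (Fin m) ℤ_[p]) : Prop :=
  (∀ r, (A r).IsDiag) ∧
  ∃ S : ℕ → Matrix (Fin m) (Fin m) (SegRing K M.J),
    (∀ k : ℕ, 0 < k → ∀ ζ ∈ GamLevel K p n k, ∀ j,
      M.P'.act ζ ((∑ i, S k i j • e i) ⊗ₜ[K] 1) =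
        (∑ i, S k i j • e i) ⊗ₜ[K] Gam.val (∏ r, Gam.padicPow (ζ r) (A r j j))) ∧
    (∃ l : ℝ, 0 < l ∧ ∀ k : ℕ, 0 < k → ∀ i j, segNorm (S k i j) ≤ (p : ℝ) ^ (l * k)) ∧
    (∀ k : ℕ, 0 < k → 1 ≤ segNorm (S k).det)

/-- `A` is an exponent of `P`: it is admitted by some model of `P`. -/
def Crho.IsExponent (P : Crho.{u, v} K p ρ) {m : ℕ}
    (A : Fin n → Matrix (Fin m) (Fin m) ℤ_[p]) : Prop :=
  ∃ (M : Model P.toGammaModule) (e : Module.Basis (Fin m) (SegRing K M.J) M.P'.carrier),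
    M.IsExponent e A

end Category

end PAdicFuchs

end

noncomputable section

open Filter Topology TensorProduct

set_option linter.unusedSectionVars false

namespace PAdicFuchs

universe u v

/-! ### The field `K(Γ)` -/

/-! The action is `K(Γ)`-linear, and each `Γ_k^n` is a finite abelian group whose characters are `ζ
↦ ζ^a`, with `a` taken modulo `p^k`. Averaging `ζ^{-a} ζ^*` over `Γ_k^n` projects onto the
`a`-isotypic part. By orthogonality of characters the projector for `a` is the sum of the `p^n`
projectors at level `k + 1` for the lifts of `a` (`GammaModule.sum_proj_lift`). Compatibility with
Galois makes the projection of a vector of `P'` a vector of `P'` again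
(`GammaModule.GaloisCompatible.exists_descent`).

At level 0 the projector is the identity, and the basis has determinant 1. Suppose the determinant
of the projected basis vectors at level `k` has norm at least 1. Split each column into its `p^n`
refinements: by multilinearity the determinant is a sum over choices of lifts, and by the
ultrametric inequality some choice still has norm at least 1
(`GammaModule.GaloisCompatible.exists_coherent`). The chosen exponents are coherent modulo `p^k` and
converge in `ℤ_p`; the limits form `A`, and the projected vectors are the columns of `S_k`.
Averaging costs only `|p^{-kn}| = p^{kn}` beyond the bound on the action (`segNorm_repr_le`).
Another basis alters determinants and norms by constants, which a power of `p` compensates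
(`Model.exists_exponent`). -/

theorem charZero_of_norm_natCast {K : Type u} [NontriviallyNormedField K] [IsUltrametricDist K]
    {p : ℕ} [Fact p.Prime] (hp : ‖(p : K)‖ = (p : ℝ)⁻¹) : CharZero K := by
  have hp1 : (1 : ℝ) < p := by exact_mod_cast (Fact.out : p.Prime).one_lt
  have hlt : ‖(p : K)‖ < 1 := by rw [hp]; exact inv_lt_one_of_one_lt₀ hp1
  have hne : (p : K) ≠ 0 := by
    rw [← norm_ne_zero_iff, hp]; positivity
  obtain ⟨q, hq⟩ := CharP.exists K
  rcases CharP.char_is_prime_or_zero K q with h | h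
  · exfalso
    -- A prime characteristic `q` would be coprime to `p`, so Bézout would give `p` an inverse that
    -- is the image of an integer, of norm at most 1, against `‖p‖ < 1`.
    have hpq : ¬ q ∣ p := fun h' => hne ((CharP.cast_eq_zero_iff K q p).2 h')
    have hcop : IsCoprime (q : ℤ) (p : ℤ) := Nat.isCoprime_iff_coprime.2 (h.coprime_iff_not_dvd.2 hpq)
    obtain ⟨a, b, hab⟩ := hcop
    have h1 : (b : K) * (p : K) = 1 := by
      have := congrArg (Int.cast : ℤ → K) hab
      push_cast at this
      rwa [CharP.cast_eq_zero K q, mul_zero, zero_add] at this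
    have h2 := congrArg norm h1
    rw [norm_mul, norm_one] at h2
    have h3 : ‖(b : K)‖ ≤ 1 := IsUltrametricDist.norm_intCast_le_one K b
    nlinarith [norm_nonneg (b : K), norm_nonneg (p : K)]
  · subst h; exact CharP.charP_to_charZero K

/-- Embeddings over `K` map the generating roots of unity to roots of unity of the same kind, which
gives normality; separability is automatic in characteristic 0. -/
theorem isGalois_KGam (K : Type u) [Field K] [CharZero K] (p : ℕ) : IsGalois K (KGam K p) := by
  rw [isGalois_iff]
  refine ⟨inferInstance, ?_⟩
  rw [IntermediateField.normal_iff_forall_map_le]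
  intro f
  rw [IntermediateField.adjoin_map, IntermediateField.adjoin_le_iff]
  rintro _ ⟨x, ⟨s, hs⟩, rfl⟩
  exact IntermediateField.subset_adjoin _ _ ⟨s, by rw [← map_pow, hs, map_one]⟩

/-- Galois descent for vectors of an extension of scalars. -/
theorem exists_tmul_one_of_fixed {K : Type u} {L : Type*} {M : Type v} [Field K] [Field L]
    [Algebra K L] [IsGalois K L] [AddCommGroup M] [Module K M] (x : M ⊗[K] L)
    (hx : ∀ τ : L ≃ₐ[K] L, TensorProduct.map LinearMap.id τ.toLinearMap x = x) :
    ∃ y : M, y ⊗ₜ[K] 1 = x := by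
  classical
  -- A `K`-basis of `M` turns the Galois action into the coordinatewise one, so the claim reduces to
  -- the fixed field of `L` being `K`.
  let b := Module.Basis.ofVectorSpace K M
  let φ : M ⊗[K] L ≃ₗ[K] _ := TensorProduct.equivFinsuppOfBasisLeft b
  have hφ : ∀ (τ : L ≃ₐ[K] L) (z : M ⊗[K] L) i,
      φ (TensorProduct.map LinearMap.id τ.toLinearMap z) i = τ (φ z i) := by
    intro τ z i
    induction z with
    | zero => simp
    | add z w hz hw => simp [hz, hw]
    | tmul m a => simp [φ]
  have h : ∀ i, φ x i ∈ Set.range (algebraMap K L) := fun i =>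
    (InfiniteGalois.mem_range_algebraMap_iff_fixed _).2 fun τ => by rw [← hφ, hx]
  choose c hc using h
  have hfin : ∀ i, c i ≠ 0 → φ x i ≠ 0 := fun i hi h0 => hi <| by
    rw [← hc] at h0; exact (map_eq_zero _).1 h0
  let c' : _ →₀ K := Finsupp.onFinset (φ x).support c fun i hi =>
    Finsupp.mem_support_iff.2 (hfin i hi)
  refine ⟨b.repr.symm c', φ.injective ?_⟩
  ext i
  simp only [φ]
  rw [TensorProduct.equivFinsuppOfBasisLeft_apply_tmul_apply]
  simp only [LinearEquiv.apply_symm_apply]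
  rw [← Algebra.algebraMap_eq_smul_one]
  exact hc i

/-! ### Characters of `Γ_k^n` and their orthogonality. -/

namespace Gam

variable {K : Type u} [Field K] {p n : ℕ}

@[simp] theorem val_one : val (1 : Gam K p) = 1 := rfl

@[simp] theorem val_mul (z w : Gam K p) : val (z * w) = val z * val w := rfl

theorem val_ne_zero (z : Gam K p) : val z ≠ 0 := Units.ne_zero _

theorem val_injective : Function.Injective (val : Gam K p → KGam K p) := fun _ _ h =>
  Subtype.ext (Units.ext h)

@[simp] theorem val_pow (z : Gam K p) (s : ℕ) : val (z ^ s) = val z ^ s := by simp [val]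

theorem char_ne_zero (ζ : Fin n → Gam K p) (i : Fin n → ℤ) : char ζ i ≠ 0 := val_ne_zero _

theorem char_zero_right (ζ : Fin n → Gam K p) : char ζ 0 = 1 := by simp [char]

theorem char_add (ζ : Fin n → Gam K p) (i j : Fin n → ℤ) :
    char ζ (i + j) = char ζ i * char ζ j := by
  simp only [char, Pi.add_apply, zpow_add, Finset.prod_mul_distrib, val_mul]

theorem char_one_left (i : Fin n → ℤ) : char (1 : Fin n → Gam K p) i = 1 := by simp [char]

theorem char_mul_left (ζ η : Fin n → Gam K p) (i : Fin n → ℤ) :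
    char (ζ * η) i = char ζ i * char η i := by
  simp only [char, Pi.mul_apply, mul_zpow, Finset.prod_mul_distrib, val_mul]

theorem val_gal (τ : KGam K p ≃ₐ[K] KGam K p) (z : Gam K p) : val (gal τ z) = τ (val z) := rfl

/-- The Galois action on `Γ` as a group automorphism. -/
def galEquiv (τ : KGam K p ≃ₐ[K] KGam K p) : Gam K p ≃* Gam K p where
  toFun := gal τ
  invFun := gal τ.symm
  left_inv z := val_injective (by simp [val_gal])
  right_inv z := val_injective (by simp [val_gal])
  map_mul' z w := val_injective (by simp [val_gal])

theorem char_gal (τ : KGam K p ≃ₐ[K] KGam K p) (ζ : Fin n → Gam K p) (i : Fin n → ℤ) :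
    char (fun j => gal τ (ζ j)) i = τ (char ζ i) := by
  change val (∏ j, galEquiv τ (ζ j) ^ i j) = _
  simp only [← map_zpow, ← map_prod]
  rfl

theorem finite_level [Fact p.Prime] (k : ℕ) : (GamLevel K p n k).Finite := by
  have h1 : {z : Gam K p | z ^ p ^ k = 1}.Finite := by
    refine Set.Finite.of_finite_image (f := val) ?_ val_injective.injOn
    refine (Polynomial.nthRootsFinset (p ^ k) (1 : KGam K p)).finite_toSet.subset ?_
    rintro _ ⟨z, hz, rfl⟩
    rw [Finset.mem_coe, Polynomial.mem_nthRootsFinset (pow_pos (Fact.out : p.Prime).pos _),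
      ← val_pow, show z ^ p ^ k = 1 from hz, val_one]
  exact (Set.Finite.pi' fun _ : Fin n => h1).subset fun ζ hζ j => hζ j

variable (K p n) in
/-- The group `Γ_k^n` as a finite set. -/
def level [Fact p.Prime] (k : ℕ) : Finset (Fin n → Gam K p) := (finite_level k).toFinset

theorem mem_level [Fact p.Prime] {k : ℕ} {ζ : Fin n → Gam K p} :
    ζ ∈ level K p n k ↔ ∀ j, ζ j ^ p ^ k = 1 := by
  simp [level, GamLevel]

theorem level_zero [Fact p.Prime] : level K p n 0 = {1} := by
  ext ζ
  simp [mem_level, funext_iff]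

theorem level_mono [Fact p.Prime] (k : ℕ) : level K p n k ⊆ level K p n (k + 1) := fun ζ h => by
  rw [mem_level] at h ⊢
  intro j
  rw [pow_succ, pow_mul, h, one_pow]

/-- The exponents which lift `a` modulo `p^k`, up to congruence modulo `p^(k+1)`. -/
def lift (k : ℕ) (a : Fin n → ℤ) (b : Fin n → Fin p) : Fin n → ℤ :=
  fun j => a j + (p : ℤ) ^ k * ((b j : ℕ) : ℤ)

/-- The sum factors over the coordinates into geometric sums in `ζ_j^{-p^k}`. These are `p`-th roots
of unity, so a factor is `p` or 0 according to whether `ζ_j` lies in `Γ_k`. -/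
theorem sum_char_lift [Fact p.Prime] (k : ℕ) (a : Fin n → ℤ) {ζ : Fin n → Gam K p}
    (hζ : ζ ∈ level K p n (k + 1)) [Decidable (ζ ∈ level K p n k)] :
    ∑ b : Fin n → Fin p, (char ζ (lift k a b))⁻¹ =
      if ζ ∈ level K p n k then (p : KGam K p) ^ n * (char ζ a)⁻¹ else 0 := by
  have h1 : ∀ b : Fin n → Fin p, (char ζ (lift k a b))⁻¹ =
      (char ζ a)⁻¹ * ∏ j, ((val (ζ j ^ p ^ k))⁻¹) ^ (b j : ℕ) := by
    intro b
    rw [show lift k a b = a + fun j => (p : ℤ) ^ k * ((b j : ℕ) : ℤ) from rfl, char_add, mul_inv]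
    congr 1
    have : ∀ j, ζ j ^ ((p : ℤ) ^ k * ((b j : ℕ) : ℤ)) = (ζ j ^ p ^ k) ^ (b j : ℕ) := fun j => by
      rw [← pow_mul, ← zpow_natCast]; push_cast; rfl
    simp only [char, this]
    have hprod : ∀ w : Fin n → Gam K p, val (∏ j, w j) = ∏ j, val (w j) := fun w => by
      simp [val]
    rw [hprod, ← Finset.prod_inv_distrib]
    exact Finset.prod_congr rfl fun j _ => by rw [val_pow (ζ j ^ p ^ k), inv_pow]
  have h2 : ∑ b : Fin n → Fin p, (char ζ (lift k a b))⁻¹ =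
      (char ζ a)⁻¹ * ∏ j, ∑ c : Fin p, ((val (ζ j ^ p ^ k))⁻¹) ^ (c : ℕ) := by
    simp only [h1, ← Finset.mul_sum]
    rw [Finset.prod_univ_sum, Fintype.piFinset_univ]
  rw [h2]
  split_ifs with h
  · rw [mem_level] at h
    simp [h, mul_comm]
  · rw [mem_level] at h hζ
    push Not at h
    obtain ⟨j, hj⟩ := h
    have h0 : ∑ c : Fin p, ((val (ζ j ^ p ^ k))⁻¹) ^ (c : ℕ) = 0 := by
      rw [Fin.sum_univ_eq_sum_range fun c => ((val (ζ j ^ p ^ k))⁻¹) ^ c]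
      have hne : (val (ζ j ^ p ^ k))⁻¹ ≠ 1 := fun h' => hj (val_injective (inv_eq_one.1 h'))
      rw [geom_sum_eq hne, inv_pow, ← val_pow, ← pow_mul, ← pow_succ, hζ]
      simp
    rw [Finset.prod_eq_zero (Finset.mem_univ j) h0, mul_zero]

end Gam

/-! ### Isotypic projections -/

/-- Multiplication by scalars of `L` on `M ⊗ L`. -/
def scal (K : Type u) (L : Type*) (M : Type v) [Field K] [Field L] [Algebra K L] [AddCommGroup M]
    [Module K M] : L →+* Module.End K (M ⊗[K] L) where
  toFun a := LinearMap.lTensor M (LinearMap.mulLeft K a)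
  map_one' := by ext; simp
  map_mul' a b := by ext; simp
  map_zero' := by ext; simp
  map_add' a b := by ext; simp [add_mul, TensorProduct.tmul_add]

theorem scal_tmul {K : Type u} {L : Type*} {M : Type v} [Field K] [Field L] [Algebra K L]
    [AddCommGroup M] [Module K M] (a : L) (x : M) (b : L) :
    scal K L M a (x ⊗ₜ[K] b) = x ⊗ₜ[K] (a * b) := rfl

theorem map_scal {K : Type u} {L : Type*} {M : Type v} [Field K] [Field L] [Algebra K L]
    [AddCommGroup M] [Module K M] (τ : L ≃ₐ[K] L) (a : L) (x : M ⊗[K] L) :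
    TensorProduct.map LinearMap.id τ.toLinearMap (scal K L M a x) =
      scal K L M (τ a) (TensorProduct.map LinearMap.id τ.toLinearMap x) := by
  induction x with
  | zero => simp
  | add x y hx hy => simp [hx, hy]
  | tmul m b => simp [scal_tmul]

section

variable {K : Type u} [NontriviallyNormedField K] [CompleteSpace K] [IsUltrametricDist K]
  {p : ℕ} [Fact p.Prime] {n : ℕ} {F : Filter (Radii n)} [F.NeBot]

instance : Nontrivial (Laurent K F) := ⟨⟨1, 0, fun h => by
  have := congrFun (congrArg Laurent.coeffs h) 0
  simp [Laurent.coeffs_one] at this⟩⟩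

/-- Constants are supported at the exponent 0, where every character takes the value 1. -/
theorem twist_one_tmul (ζ : Fin n → Gam K p) (a : KGam K p) :
    twist ζ ((1 : Laurent K F) ⊗ₜ[K] a) = 1 ⊗ₜ[K] a := by
  classical
  have h : ∀ c : KGam K p, TensorProduct.map (Laurent.restrict {i | Gam.char ζ i = c})
      (LinearMap.mulLeft K c) ((1 : Laurent K F) ⊗ₜ[K] a) =
        if 1 = c then (1 : Laurent K F) ⊗ₜ[K] a else 0 := by
    intro c
    have hr : Laurent.restrict {i | Gam.char ζ i = c} (1 : Laurent K F) =
        if 1 = c then 1 else 0 := by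
      apply Laurent.ext_coeffs
      funext i
      change Set.indicator {i | Gam.char ζ i = c} (Laurent.coeffs (1 : Laurent K F)) i = _
      by_cases hi : i = 0
      · subst hi
        by_cases hc : 1 = c
        · rw [if_pos hc, Set.indicator_of_mem]
          exact (Gam.char_zero_right ζ).trans hc
        · rw [if_neg hc, Set.indicator_of_notMem, map_zero, Pi.zero_apply]
          exact fun h' => hc ((Gam.char_zero_right ζ).symm.trans h')
      · have h0 : Laurent.coeffs (1 : Laurent K F) i = 0 := by
          rw [Laurent.coeffs_one, Pi.single_eq_of_ne hi]
        rw [Set.indicator_apply, h0]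
        split_ifs <;> simp [h0]
    rw [TensorProduct.map_tmul, hr]
    split_ifs with hc
    · subst hc; simp
    · simp
  rw [twist, LinearMap.sum_apply]
  simp only [h]
  rw [Finset.sum_ite_eq, if_pos]
  simp only [Set.Finite.mem_toFinset]
  exact ⟨0, Gam.char_zero_right ζ⟩

theorem extSmul_one_tmul {M : Type v} [AddCommGroup M] [Module K M] [Module (Laurent K F) M]
    [IsScalarTower K (Laurent K F) M] (a : KGam K p) (x : M ⊗[K] KGam K p) :
    extSmul ((1 : Laurent K F) ⊗ₜ[K] a) x = scal K (KGam K p) M a x := by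
  induction x with
  | zero => simp
  | add x y hx hy => simp [hx, hy]
  | tmul m b => simp [extSmul, scal_tmul]

namespace GammaModule

variable (M : GammaModule.{u, v} K p F)

/-- Since constants are not twisted, semilinearity contains genuine `K(Γ)`-linearity; this is what
makes averaging against characters possible. -/
theorem act_scal (ζ : Fin n → Gam K p) (a : KGam K p) (x : M.carrier ⊗[K] KGam K p) :
    M.act ζ (scal K (KGam K p) M.carrier a x) = scal K (KGam K p) M.carrier a (M.act ζ x) := by
  rw [← extSmul_one_tmul (F := F), M.semilinear, twist_one_tmul, extSmul_one_tmul]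

/-- The projection to the part of `M ⊗ K(Γ)` on which `Γ_k^n` acts by `ζ ↦ ζ^a`. -/
def proj (k : ℕ) (a : Fin n → ℤ) (x : M.carrier ⊗[K] KGam K p) : M.carrier ⊗[K] KGam K p :=
  scal K (KGam K p) M.carrier ((p : KGam K p) ^ (k * n))⁻¹
    (∑ ζ ∈ Gam.level K p n k, scal K (KGam K p) M.carrier (Gam.char ζ a)⁻¹ (M.act ζ x))

theorem proj_zero (a : Fin n → ℤ) (x : M.carrier ⊗[K] KGam K p) : M.proj 0 a x = x := by
  simp [proj, Gam.level_zero, Gam.char_one_left]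

/-- Translating the summation variable by `η` permutes `Γ_k^n` and brings out the factor `η^a`. -/
theorem act_proj {k : ℕ} (a : Fin n → ℤ) (x : M.carrier ⊗[K] KGam K p) {η : Fin n → Gam K p}
    (hη : η ∈ Gam.level K p n k) :
    M.act η (M.proj k a x) = scal K (KGam K p) M.carrier (Gam.char η a) (M.proj k a x) := by
  rw [proj, act_scal, ← Module.End.mul_apply, ← map_mul, mul_comm (Gam.char η a), map_mul,
    Module.End.mul_apply]
  congr 1
  rw [map_sum, map_sum]
  refine Finset.sum_bij (fun ζ _ => η * ζ) ?_ ?_ ?_ ?_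
  · intro ζ hζ
    rw [Gam.mem_level] at *
    intro j
    rw [Pi.mul_apply, mul_pow, hη, hζ, one_mul]
  · intro ζ _ ξ _ h
    exact mul_left_cancel h
  · intro ζ hζ
    refine ⟨η⁻¹ * ζ, ?_, by simp⟩
    rw [Gam.mem_level] at *
    intro j
    rw [Pi.mul_apply, Pi.inv_apply, mul_pow, inv_pow, hη, hζ, inv_one, one_mul]
  · intro ζ _
    rw [act_scal, ← Module.End.mul_apply, ← map_mul, Gam.char_mul_left, mul_inv, ← mul_assoc,
      mul_inv_cancel₀ (Gam.char_ne_zero η a), one_mul, map_mul M.act]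
    rfl

/-- Orthogonality kills the terms outside `Γ_k^n`; on the others it contributes `p^n`, the ratio of
the two normalising factors. -/
theorem sum_proj_lift [CharZero K] (k : ℕ) (a : Fin n → ℤ) (x : M.carrier ⊗[K] KGam K p) :
    ∑ b : Fin n → Fin p, M.proj (k + 1) (Gam.lift k a b) x = M.proj k a x := by
  classical
  have hp0 : (p : KGam K p) ≠ 0 := Nat.cast_ne_zero.2 (Fact.out : p.Prime).ne_zero
  simp only [proj]
  rw [← map_sum, Finset.sum_comm]
  have h : ∀ ζ ∈ Gam.level K p n (k + 1),
      ∑ b : Fin n → Fin p,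
        scal K (KGam K p) M.carrier (Gam.char ζ (Gam.lift k a b))⁻¹ (M.act ζ x) =
      if ζ ∈ Gam.level K p n k then scal K (KGam K p) M.carrier ((p : KGam K p) ^ n)
        (scal K (KGam K p) M.carrier (Gam.char ζ a)⁻¹ (M.act ζ x)) else 0 := by
    intro ζ hζ
    rw [← LinearMap.sum_apply, ← map_sum, Gam.sum_char_lift k a hζ]
    split_ifs
    · rw [map_mul]; rfl
    · simp
  rw [Finset.sum_congr rfl h, ← Finset.sum_filter, Finset.filter_mem_eq_inter,
    Finset.inter_eq_right.2 (Gam.level_mono k), ← map_sum, ← Module.End.mul_apply, ← map_mul]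
  congr 2
  rw [add_mul, one_mul, pow_add]
  field_simp

/-- The compatibility of the action with the Galois action. -/
def GaloisCompatible : Prop :=
  ∀ (τ : KGam K p ≃ₐ[K] KGam K p) (ζ : Fin n → Gam K p) (x : M.carrier ⊗[K] KGam K p),
    TensorProduct.map LinearMap.id τ.toLinearMap (M.act ζ x) =
      M.act (fun j => Gam.gal τ (ζ j)) (TensorProduct.map LinearMap.id τ.toLinearMap x)

variable {M}

/-- Galois permutes `Γ_k^n` and satisfies `τ(ζ^a) = τ(ζ)^a`, so it only reindexes the average. -/
theorem GaloisCompatible.map_proj (hM : M.GaloisCompatible) (k : ℕ) (a : Fin n → ℤ)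
    (τ : KGam K p ≃ₐ[K] KGam K p) (x : M.carrier ⊗[K] KGam K p) :
    TensorProduct.map LinearMap.id τ.toLinearMap (M.proj k a x) =
      M.proj k a (TensorProduct.map LinearMap.id τ.toLinearMap x) := by
  rw [proj, map_scal, map_sum, proj]
  congr 1
  · simp
  refine Finset.sum_bij (fun ζ _ j => Gam.galEquiv τ (ζ j)) ?_ ?_ ?_ ?_
  · intro ζ hζ
    rw [Gam.mem_level] at *
    intro j
    rw [← map_pow, hζ, map_one]
  · intro ζ _ ξ _ h
    exact funext fun j => (Gam.galEquiv τ).injective (congrFun h j)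
  · intro ζ hζ
    refine ⟨fun j => (Gam.galEquiv τ).symm (ζ j), ?_, by simp⟩
    rw [Gam.mem_level] at *
    intro j
    rw [← map_pow, hζ, map_one]
  · intro ζ _
    rw [map_scal, hM, map_inv₀, ← Gam.char_gal]
    rfl

/-- The vector `x ⊗ 1` is Galois-fixed, hence so is its projection. This is why `S_k` has entries in
`K_{J,n}` and not merely in `K_{J,n} ⊗ K(Γ)`. -/
theorem GaloisCompatible.exists_descent [CharZero K] (hM : M.GaloisCompatible) (k : ℕ)
    (a : Fin n → ℤ) (x : M.carrier) :
    ∃ y : M.carrier, y ⊗ₜ[K] 1 = M.proj k a (x ⊗ₜ[K] 1) := by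
  have := isGalois_KGam K p
  refine exists_tmul_one_of_fixed _ fun τ => ?_
  rw [hM.map_proj, TensorProduct.map_tmul]
  simp

theorem tmul_one_injective (M : Type v) [AddCommGroup M] [Module K M] :
    Function.Injective fun x : M => x ⊗ₜ[K] (1 : KGam K p) := by
  intro x y h
  apply Module.Flat.tensorProduct_mk_injective (R := K) (S := KGam K p) M
  have := congrArg (TensorProduct.comm K M (KGam K p)) h
  simpa using this

end GammaModule

end

/-! ### Transfer from an object to its models. -/

section Model

variable {K : Type u} [NontriviallyNormedField K] [CompleteSpace K] [IsUltrametricDist K]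
  {p : ℕ} [Fact p.Prime] {n : ℕ} {ρ : Radii n}

theorem algebraMap_germRing_injective (J : Polysegment ρ) :
    Function.Injective (algebraMap (SegRing K J) (GermRing K ρ)) := fun f g h => by
  apply Laurent.ext_coeffs
  exact congrArg (Laurent.coeffs (F := 𝓝 ρ)) h

/-- `P'` is free, hence flat, over `K_{J,n}`, which embeds in `R_ρ`. -/
theorem Model.extMap_injective {P : GammaModule.{u, v} K p (𝓝 ρ)} (M : Model P) :
    Function.Injective (extMap M.iso) := by
  have : FaithfulSMul (SegRing K M.J) (GermRing K ρ) :=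
    (faithfulSMul_iff_algebraMap_injective _ _).2 (algebraMap_germRing_injective M.J)
  intro x y h
  exact Module.Flat.tensorProduct_mk_injective (R := SegRing K M.J) (S := GermRing K ρ) _
    (M.iso.injective h)

/-- Condition (b) is imposed on `P` only; it is pulled back along the injection `P' ⊗ K(Γ) → P ⊗
K(Γ)`, which commutes with both actions. -/
theorem Model.galoisCompatible {P : GammaModule.{u, v} K p (𝓝 ρ)} (M : Model P)
    (hP : P.GaloisCompatible) : M.P'.GaloisCompatible := by
  intro τ ζ x
  have hinj : Function.Injective
      (TensorProduct.map (extMap M.iso) (LinearMap.id : KGam K p →ₗ[K] KGam K p)) :=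
    Module.Flat.rTensor_preserves_injective_linearMap _ M.extMap_injective
  have hcomm : ∀ z, TensorProduct.map (extMap M.iso) LinearMap.id
      (TensorProduct.map LinearMap.id τ.toLinearMap z) =
      TensorProduct.map LinearMap.id τ.toLinearMap
        (TensorProduct.map (extMap M.iso) LinearMap.id z) := fun z => by
    rw [← LinearMap.comp_apply, ← LinearMap.comp_apply, ← TensorProduct.map_comp,
      ← TensorProduct.map_comp]
    rfl
  apply hinj
  rw [hcomm, ← M.act_comm, hP, ← M.act_comm, hcomm]

theorem Model.finrank_eq {P : GammaModule.{u, v} K p (𝓝 ρ)} (M : Model P) :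
    Module.finrank (GermRing K ρ) P.carrier =
      Module.finrank (SegRing K M.J) M.P'.carrier := by
  rw [← M.iso.finrank_eq, Module.finrank_baseChange]

end Model

/-! ### The supremum norm -/

section Norm

variable {K : Type u} [NontriviallyNormedField K] [CompleteSpace K] [IsUltrametricDist K]
  {p : ℕ} {n : ℕ} {ρ : Radii n} {J : Polysegment ρ}

/-- On a polysegment, a monomial takes its largest value at a vertex. -/
theorem wt_le_vertex {σ : Radii n} (hσ : σ ∈ J.toSet) (i : Fin n → ℤ) :
    wt σ i ≤ wt (fun j => if 0 ≤ i j then J.hi j else J.lo j) i := by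
  refine Finset.prod_le_prod (fun j _ => (zpow_pos (σ j).2 _).le) fun j _ => ?_
  have h1 : (J.lo j : ℝ) ≤ σ j := hσ.1 j
  have h2 : (σ j : ℝ) ≤ J.hi j := hσ.2 j
  dsimp only
  split_ifs with h
  · exact zpow_le_zpow_left₀ h (σ j).2.le h2
  · have := inv_anti₀ (zpow_pos (J.lo j).2 _)
      (zpow_le_zpow_left₀ (neg_nonneg.2 (not_le.1 h).le) (J.lo j).2.le h1)
    simpa only [zpow_neg, inv_inv] using this

/-- Decay at each of the finitely many vertices of `J` gives a bound uniform on `J`. Without it the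
real suprema in `segNorm` could take their default value 0. -/
theorem exists_bound (f : SegRing K J) :
    ∃ C, ∀ σ ∈ J.toSet, ∀ i, ‖Laurent.coeffs f i‖ * wt σ i ≤ C := by
  have hJ : J.lo ≤ J.hi := fun j => ((J.lo_lt j).trans (J.lt_hi j)).le
  have h : ∀ s : Fin n → Bool, ∃ C, ∀ i,
      ‖Laurent.coeffs f i‖ * wt (fun j => if s j then J.hi j else J.lo j) i ≤ C := fun s => by
    refine Decays.bound (mem_principal.1 f.2 ⟨fun j => ?_, fun j => ?_⟩)
    · by_cases h : s j
      · simpa [h] using hJ j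
      · simp [h]
    · by_cases h : s j
      · simp [h]
      · simpa [h] using hJ j
  choose C hC using h
  have hC0 : ∀ s, 0 ≤ C s := fun s =>
    (mul_nonneg (norm_nonneg _) (wt_pos _ 0).le).trans (hC s 0)
  refine ⟨∑ s, C s, fun σ hσ i => ?_⟩
  calc ‖Laurent.coeffs f i‖ * wt σ i
      ≤ ‖Laurent.coeffs f i‖ * wt (fun j => if 0 ≤ i j then J.hi j else J.lo j) i :=
        mul_le_mul_of_nonneg_left (wt_le_vertex hσ i) (norm_nonneg _)
    _ ≤ C fun j => decide (0 ≤ i j) := by simpa using hC (fun j => decide (0 ≤ i j)) i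
    _ ≤ ∑ s, C s := Finset.single_le_sum (fun s _ => hC0 s) (Finset.mem_univ _)

theorem le_iSup_iSup_of_bound {ι κ : Type*} [Nonempty κ] {φ : ι → κ → ℝ} {C : ℝ}
    (hC : ∀ x y, φ x y ≤ C) (x : ι) (y : κ) : φ x y ≤ ⨆ x, ⨆ y, φ x y := by
  have h1 : BddAbove (Set.range fun x => ⨆ y, φ x y) :=
    ⟨C, by rintro _ ⟨x, rfl⟩; exact ciSup_le (hC x)⟩
  have h2 : BddAbove (Set.range (φ x)) := ⟨C, by rintro _ ⟨y, rfl⟩; exact hC x y⟩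
  exact le_ciSup_of_le h1 x (le_ciSup h2 y)

theorem le_segNorm (f : SegRing K J) {σ : Radii n} (hσ : σ ∈ J.toSet) (i : Fin n → ℤ) :
    ‖Laurent.coeffs f i‖ * wt σ i ≤ segNorm f := by
  obtain ⟨C, hC⟩ := exists_bound f
  exact le_iSup_iSup_of_bound (φ := fun (σ : J.toSet) i => ‖Laurent.coeffs f i‖ * wt σ i)
    (fun σ i => hC σ σ.2 i) ⟨σ, hσ⟩ i

theorem segNorm_le {f : SegRing K J} {C : ℝ} (hC : 0 ≤ C)
    (h : ∀ σ ∈ J.toSet, ∀ i, ‖Laurent.coeffs f i‖ * wt σ i ≤ C) : segNorm f ≤ C :=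
  Real.iSup_le (fun σ => Real.iSup_le (fun i => h σ σ.2 i) hC) hC

theorem segNorm_nonneg (f : SegRing K J) : 0 ≤ segNorm f :=
  Real.iSup_nonneg fun _ => Real.iSup_nonneg fun i =>
    mul_nonneg (norm_nonneg _) (wt_pos _ i).le

theorem one_le_segNorm_one : 1 ≤ segNorm (1 : SegRing K J) := by
  have h := le_segNorm (1 : SegRing K J) J.mem_toSet 0
  simpa [Laurent.coeffs_one, wt] using h

theorem segNorm_sum_le {ι : Type*} (s : Finset ι) (f : ι → SegRing K J) {C : ℝ} (hC : 0 ≤ C)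
    (h : ∀ x ∈ s, segNorm (f x) ≤ C) : segNorm (∑ x ∈ s, f x) ≤ C := by
  refine segNorm_le hC fun σ hσ i => ?_
  rw [map_sum, Finset.sum_apply, ← le_div_iff₀ (wt_pos σ i)]
  refine IsUltrametricDist.norm_sum_le_of_forall_le_of_nonneg
    (div_nonneg hC (wt_pos σ i).le) fun x hx => ?_
  rw [le_div_iff₀ (wt_pos σ i)]
  exact (le_segNorm (f x) hσ i).trans (h x hx)

/-- An ultrametric sum is no larger than its largest term. This selects the lifts of the exponents.
-/
theorem exists_one_le_segNorm {ι : Type*} [Finite ι] [Nonempty ι] {s : Finset ι}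
    {f : ι → SegRing K J} (h : 1 ≤ segNorm (∑ x ∈ s, f x)) : ∃ x, 1 ≤ segNorm (f x) := by
  obtain ⟨x, hx⟩ := Finite.exists_max fun x => segNorm (f x)
  exact ⟨x, h.trans (segNorm_sum_le s f (segNorm_nonneg _) fun y _ => hx y)⟩

theorem segNorm_mul_le (f g : SegRing K J) : segNorm (f * g) ≤ segNorm f * segNorm g := by
  refine segNorm_le (mul_nonneg (segNorm_nonneg f) (segNorm_nonneg g)) fun σ hσ k => ?_
  rw [Laurent.coeffs_mul, ← le_div_iff₀ (wt_pos σ k)]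
  refine norm_tsum_le ((mem_principal.1 f.2 hσ : Decays _ σ).summable (mem_principal.1 g.2 hσ) k)
    (div_nonneg (mul_nonneg (segNorm_nonneg f) (segNorm_nonneg g)) (wt_pos σ k).le) fun i => ?_
  rw [le_div_iff₀ (wt_pos σ k), norm_mul,
    show wt σ k = wt σ i * wt σ (k - i) by rw [← wt_add, add_sub_cancel], mul_mul_mul_comm]
  exact mul_le_mul (le_segNorm f hσ i) (le_segNorm g hσ _)
    (mul_nonneg (norm_nonneg _) (wt_pos _ _).le) (segNorm_nonneg f)

theorem segNorm_smul_le (c : K) (f : SegRing K J) : segNorm (c • f) ≤ ‖c‖ * segNorm f := by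
  refine segNorm_le (mul_nonneg (norm_nonneg c) (segNorm_nonneg f)) fun σ hσ i => ?_
  rw [map_smul, Pi.smul_apply, norm_smul, mul_assoc]
  exact mul_le_mul_of_nonneg_left (le_segNorm f hσ i) (norm_nonneg c)

theorem norm_mul_segNorm_le {c : K} (hc : c ≠ 0) (f : SegRing K J) :
    ‖c‖ * segNorm f ≤ segNorm (c • f) := by
  have h := segNorm_smul_le c⁻¹ (c • f)
  rw [inv_smul_smul₀ hc, norm_inv, inv_mul_eq_div, le_div_iff₀ (norm_pos_iff.2 hc)] at h
  linarith

/-! ### The supremum norm over `K(Γ)` -/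

theorem spectralNorm_KGam_mul (x y : KGam K p) :
    spectralNorm K (KGam K p) (x * y) =
      spectralNorm K (KGam K p) x * spectralNorm K (KGam K p) y :=
  map_mul (spectralMulAlgNorm K (KGam K p)) x y

theorem spectralNorm_KGam_sum_le {ι : Type*} (s : Finset ι) (x : ι → KGam K p) {C : ℝ}
    (hC : 0 ≤ C) (h : ∀ i ∈ s, spectralNorm K (KGam K p) (x i) ≤ C) :
    spectralNorm K (KGam K p) (∑ i ∈ s, x i) ≤ C :=
  Finset.sum_induction x (fun y => spectralNorm K (KGam K p) y ≤ C)
    (fun a b ha hb => (isNonarchimedean_spectralNorm a b).trans (max_le ha hb))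
    (by rw [spectralNorm_zero]; exact hC) h

theorem spectralNorm_gam [Fact p.Prime] (z : Gam K p) :
    spectralNorm K (KGam K p) (Gam.val z) = 1 := by
  obtain ⟨s, hs⟩ := z.2
  have h1 : Gam.val z ^ p ^ s = 1 := by
    rw [← Gam.val_pow, show z ^ p ^ s = 1 from Subtype.ext hs, Gam.val_one]
  have h2 : spectralNorm K (KGam K p) (Gam.val z) ^ p ^ s = 1 := by
    rw [← spectralMulAlgNorm_def, ← map_pow, h1, map_one]
  exact (pow_eq_one_iff_of_nonneg (spectralNorm_nonneg _)
    (pow_pos (Fact.out : p.Prime).pos _).ne').1 h2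

theorem spectralNorm_KGam_smul (c : K) (x : KGam K p) :
    spectralNorm K (KGam K p) (c • x) = ‖c‖ * spectralNorm K (KGam K p) x := by
  rw [Algebra.smul_def, spectralNorm_KGam_mul, spectralNorm_extends]

theorem coeffGam_tmul (i : Fin n → ℤ) (f : SegRing K J) (a : KGam K p) :
    coeffGam i (f ⊗ₜ[K] a) = Laurent.coeffs f i • a := rfl

theorem coeffGam_scal (i : Fin n → ℤ) (a : KGam K p) (f : SegRing K J ⊗[K] KGam K p) :
    coeffGam i (scal K (KGam K p) (SegRing K J) a f) = a * coeffGam i f := by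
  induction f with
  | zero => simp
  | add x y hx hy => rw [map_add, map_add, hx, hy, map_add, mul_add]
  | tmul g b => rw [scal_tmul, coeffGam_tmul, coeffGam_tmul, mul_smul_comm]

theorem exists_bound_gam (f : SegRing K J ⊗[K] KGam K p) :
    ∃ C, ∀ σ ∈ J.toSet, ∀ i, spectralNorm K (KGam K p) (coeffGam i f) * wt σ i ≤ C := by
  induction f with
  | zero => exact ⟨0, fun σ _ i => by rw [map_zero, spectralNorm_zero, zero_mul]⟩
  | add x y hx hy =>
    obtain ⟨C, hC⟩ := hx
    obtain ⟨D, hD⟩ := hy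
    refine ⟨max C D, fun σ hσ i => ?_⟩
    rw [map_add, ← le_div_iff₀ (wt_pos σ i)]
    refine (isNonarchimedean_spectralNorm _ _).trans (max_le ?_ ?_)
    · rw [le_div_iff₀ (wt_pos σ i)]
      exact (hC σ hσ i).trans (le_max_left _ _)
    · rw [le_div_iff₀ (wt_pos σ i)]
      exact (hD σ hσ i).trans (le_max_right _ _)
  | tmul g a =>
    refine ⟨segNorm g * spectralNorm K (KGam K p) a, fun σ hσ i => ?_⟩
    rw [coeffGam_tmul, spectralNorm_KGam_smul, mul_right_comm]
    exact mul_le_mul_of_nonneg_right (le_segNorm g hσ i) (spectralNorm_nonneg _)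

theorem le_segNormGam (f : SegRing K J ⊗[K] KGam K p) {σ : Radii n} (hσ : σ ∈ J.toSet)
    (i : Fin n → ℤ) :
    spectralNorm K (KGam K p) (coeffGam i f) * wt σ i ≤ segNormGam f := by
  obtain ⟨C, hC⟩ := exists_bound_gam f
  exact le_iSup_iSup_of_bound
    (φ := fun (σ : J.toSet) i => spectralNorm K (KGam K p) (coeffGam i f) * wt σ i)
    (fun σ i => hC σ σ.2 i) ⟨σ, hσ⟩ i

/-! ### Coordinates over `K(Γ)` -/

variable [Fact p.Prime] {M : GammaModule.{u, v} K p (𝓟 J.toSet)} {m : ℕ}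

/-- The coordinates on `M ⊗ K(Γ)` attached to a basis of `M`. -/
def coordGam (e : Module.Basis (Fin m) (SegRing K J) M.carrier) (i : Fin m) :
    M.carrier ⊗[K] KGam K p →ₗ[K] SegRing K J ⊗[K] KGam K p :=
  TensorProduct.map ((e.coord i).restrictScalars K) LinearMap.id

theorem coordGam_tmul (e : Module.Basis (Fin m) (SegRing K J) M.carrier) (i : Fin m)
    (x : M.carrier) (a : KGam K p) :
    coordGam e i (x ⊗ₜ[K] a) = e.repr x i ⊗ₜ[K] a := rfl

theorem coordGam_scal (e : Module.Basis (Fin m) (SegRing K J) M.carrier) (i : Fin m)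
    (a : KGam K p) (x : M.carrier ⊗[K] KGam K p) :
    coordGam e i (scal K (KGam K p) M.carrier a x) =
      scal K (KGam K p) (SegRing K J) a (coordGam e i x) := by
  induction x with
  | zero => simp
  | add x y hx hy => simp only [map_add, hx, hy]
  | tmul x b => rfl

theorem coordGam_extSmul (e : Module.Basis (Fin m) (SegRing K J) M.carrier) (i j : Fin m)
    (f : SegRing K J ⊗[K] KGam K p) :
    coordGam e i (extSmul f (e j ⊗ₜ[K] 1)) = if j = i then f else 0 := by
  induction f with
  | zero => simp
  | add f g hf hg =>
    rw [map_add, LinearMap.add_apply, map_add, hf, hg]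
    split_ifs <;> simp
  | tmul g a =>
    rw [extSmul, TensorProduct.map₂_apply_tmul, TensorProduct.map_tmul, coordGam_tmul]
    by_cases h : j = i
    · subst h; simp
    · simp [h]

/-- Lets the bound on the matrices `E(ζ)` be read as a bound on the coordinates of the terms of the
average. -/
theorem Represents.coordGam_act {e : Module.Basis (Fin m) (SegRing K J) M.carrier}
    {ζ : Fin n → Gam K p} {E : Matrix (Fin m) (Fin m) (SegRing K J ⊗[K] KGam K p)}
    (hE : Represents M e ζ E) (i j : Fin m) : coordGam e i (M.act ζ (e j ⊗ₜ[K] 1)) = E i j := by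
  rw [hE j, map_sum]
  simp only [coordGam_extSmul]
  simp

/-- The bound for the coordinates of an isotypic projection. -/
theorem segNorm_repr_le (hp : ‖(p : K)‖ = (p : ℝ)⁻¹)
    (e : Module.Basis (Fin m) (SegRing K J) M.carrier) {k : ℕ} {C : ℝ}
    (hE : ∀ ζ ∈ GamLevel K p n k, ∃ E : Matrix (Fin m) (Fin m) (SegRing K J ⊗[K] KGam K p),
      Represents M e ζ E ∧ ∀ i j, segNormGam (E i j) ≤ C) (hC : 0 ≤ C)
    {a : Fin n → ℤ} {j : Fin m} {y : M.carrier}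
    (hy : y ⊗ₜ[K] 1 = M.proj k a (e j ⊗ₜ[K] 1)) (i : Fin m) :
    segNorm (e.repr y i) ≤ (p : ℝ) ^ (k * n) * C := by
  have hpos : (0 : ℝ) ≤ (p : ℝ) ^ (k * n) := by positivity
  refine segNorm_le (mul_nonneg hpos hC) fun σ hσ ν => ?_
  -- Taking one Laurent coefficient of one coordinate turns the averaging formula into an identity
  -- of scalars in `K(Γ)`.
  have h1 : algebraMap K (KGam K p) (Laurent.coeffs (e.repr y i) ν) =
      ((p : KGam K p) ^ (k * n))⁻¹ * ∑ ζ ∈ Gam.level K p n k,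
        (Gam.char ζ a)⁻¹ * coeffGam ν (coordGam e i (M.act ζ (e j ⊗ₜ[K] 1))) := by
    have := congrArg (fun z => coeffGam ν (coordGam e i z)) hy
    simp only [GammaModule.proj, coordGam_scal, coeffGam_scal, map_sum, coordGam_tmul,
      coeffGam_tmul] at this
    rw [Algebra.algebraMap_eq_smul_one, Finset.mul_sum]
    exact this
  have h2 : spectralNorm K (KGam K p) ((p : KGam K p) ^ (k * n))⁻¹ = (p : ℝ) ^ (k * n) := by
    rw [show ((p : KGam K p) ^ (k * n))⁻¹ = algebraMap K (KGam K p) ((p : K) ^ (k * n))⁻¹ by simp,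
      spectralNorm_extends, norm_inv, norm_pow, hp, inv_pow, inv_inv]
  rw [← spectralNorm_extends (L := KGam K p), h1, spectralNorm_KGam_mul, h2, mul_assoc]
  refine mul_le_mul_of_nonneg_left ?_ hpos
  rw [← le_div_iff₀ (wt_pos σ ν)]
  refine spectralNorm_KGam_sum_le _ _ (div_nonneg hC (wt_pos σ ν).le) fun ζ hζ => ?_
  -- Characters have norm 1, so the only loss in averaging is the factor `p^{kn}` of `h2`.
  have h3 : spectralNorm K (KGam K p) (Gam.char ζ a)⁻¹ = 1 := by
    rw [show (Gam.char ζ a)⁻¹ = Gam.val (∏ j, ζ j ^ a j)⁻¹ by simp [Gam.char, Gam.val]]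
    exact spectralNorm_gam _
  obtain ⟨E, hrep, hb⟩ := hE ζ (Gam.mem_level.1 hζ)
  rw [spectralNorm_KGam_mul, h3, one_mul, hrep.coordGam_act, le_div_iff₀ (wt_pos σ ν)]
  exact (le_segNormGam _ hσ ν).trans (hb i j)

end Norm

/-! ### Powers with `p`-adic exponents -/

/-- The definition reduces `A` modulo `p^s` for the least `s` with `z^{p^s} = 1`; since `s ≤ k`, a
congruence modulo `p^k` is enough. -/
theorem Gam.padicPow_eq_zpow {K : Type u} [Field K] {p : ℕ} [Fact p.Prime] {k : ℕ} {z : Gam K p}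
    (hz : z ^ p ^ k = 1) {A : ℤ_[p]} {a : ℤ} (hA : PadicInt.toZModPow k A = a) :
    Gam.padicPow z A = z ^ a := by
  classical
  have hz' : ((z : (KGam K p)ˣ)) ^ p ^ k = 1 := congrArg Subtype.val hz
  rw [padicPow]
  set s := Nat.find z.2 with hs
  have hsk : s ≤ k := Nat.find_min' z.2 hz'
  have hzs : z ^ p ^ s = 1 := Subtype.ext (by simpa using Nat.find_spec z.2)
  have hAs : PadicInt.toZModPow s A = a := by
    rw [← PadicInt.cast_toZModPow s k hsk, hA]
    exact ZMod.cast_intCast (pow_dvd_pow p hsk) a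
  have hdvd : ((p ^ s : ℕ) : ℤ) ∣ a - ((PadicInt.toZModPow s A).val : ℤ) := by
    rw [← ZMod.intCast_zmod_eq_zero_iff_dvd]
    push_cast
    rw [hAs]
    simp
  obtain ⟨c, hc⟩ := hdvd
  rw [eq_add_of_sub_eq hc, zpow_add, zpow_mul, zpow_natCast, hzs, one_zpow, one_mul, zpow_natCast]

/-! ### Existence of exponents -/

section Existence

variable {K : Type u} [NontriviallyNormedField K] [CompleteSpace K] [IsUltrametricDist K]
  {p : ℕ} [Fact p.Prime] {n : ℕ} {ρ : Radii n} {m : ℕ}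

/-- A coherent sequence of exponents modulo `p^k`, with isotypic vectors whose determinants are
bounded below. -/
theorem GammaModule.GaloisCompatible.exists_coherent [CharZero K] {J : Polysegment ρ}
    {M : GammaModule.{u, v} K p (𝓟 J.toSet)} (hM : M.GaloisCompatible)
    (e : Module.Basis (Fin m) (SegRing K J) M.carrier) :
    ∃ (a : ℕ → Fin m → Fin n → ℤ) (v : ℕ → Fin m → M.carrier),
      (∀ k j r, (p : ℤ) ^ k ∣ a (k + 1) j r - a k j r) ∧
      (∀ k j, v k j ⊗ₜ[K] 1 = M.proj k (a k j) (e j ⊗ₜ[K] 1)) ∧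
      ∀ k, 1 ≤ segNorm (e.det (v k)) := by
  -- Makes `Fin p` nonempty, so that there is a lift to select.
  have : NeZero p := ⟨(Fact.out : p.Prime).ne_zero⟩
  choose D hD using hM.exists_descent
  let Good (k : ℕ) (a : Fin m → Fin n → ℤ) : Prop :=
    1 ≤ segNorm (e.det fun j => D k (a j) (e j))
  have hsum : ∀ k a x, ∑ b : Fin n → Fin p, D (k + 1) (Gam.lift k a b) x = D k a x := by
    intro k a x
    apply GammaModule.tmul_one_injective (K := K) (p := p) M.carrier
    dsimp only
    rw [TensorProduct.sum_tmul, hD]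
    simp only [hD]
    exact M.sum_proj_lift k a _
  have hzero : Good 0 0 := by
    have h0 : ∀ a x, D 0 a x = x := fun a x => by
      apply GammaModule.tmul_one_injective (K := K) (p := p) M.carrier
      dsimp only
      rw [hD, M.proj_zero]
    simp only [Good, h0]
    exact one_le_segNorm_one.trans_eq (congrArg segNorm e.det_self.symm)
  have hstep : ∀ k (a : {a // Good k a}), ∃ a' : {a' // Good (k + 1) a'},
      ∀ j r, (p : ℤ) ^ k ∣ a'.1 j r - a.1 j r := by
    rintro k ⟨a, ha⟩
    -- Each column is the sum of its `p^n` refinements, so multilinearity writes the determinant as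
    -- a sum over independent choices of a lift for every column.
    have hcol : (fun j => D k (a j) (e j)) =
        fun j => ∑ b : Fin n → Fin p, D (k + 1) (Gam.lift k (a j) b) (e j) :=
      funext fun j => (hsum k (a j) (e j)).symm
    simp only [Good] at ha
    rw [hcol, ← AlternatingMap.coe_multilinearMap, MultilinearMap.map_sum] at ha
    obtain ⟨b, hb⟩ := exists_one_le_segNorm ha
    exact ⟨⟨fun j => Gam.lift k (a j) (b j), hb⟩, fun j r => ⟨(b j r : ℕ), by
      simp [Gam.lift]⟩⟩
  choose next hnext using hstep
  let a : (k : ℕ) → {a // Good k a} := fun k => Nat.rec ⟨0, hzero⟩ next k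
  exact ⟨fun k => (a k).1, fun k j => D k ((a k).1 j) (e j), fun k => hnext k (a k),
    fun k j => hD _ _ _, fun k => (a k).2⟩

/-- The vectors are built from a basis with controlled matrices, but their isotypy does not involve
a basis. So the same `A` serves every basis `e'` once the coordinates are rescaled. -/
theorem Model.exists_exponent (hp : ‖(p : K)‖ = (p : ℝ)⁻¹) {P : GammaModule.{u, v} K p (𝓝 ρ)}
    (hP : P.GaloisCompatible) (M : Model P)
    (hm : Module.finrank (GermRing K ρ) P.carrier = m) :
    ∃ A : Fin n → Matrix (Fin m) (Fin m) ℤ_[p],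
      ∀ e : Module.Basis (Fin m) (SegRing K M.J) M.P'.carrier, M.IsExponent e A := by
  have := charZero_of_norm_natCast hp
  have hp1 : (1 : ℝ) < p := by exact_mod_cast (Fact.out : p.Prime).one_lt
  have hp0 : (0 : ℝ) < p := one_pos.trans hp1
  obtain ⟨m', e, l, hl, hE⟩ := M.bounded
  obtain rfl : m = m' := by
    rw [← hm, M.finrank_eq, Module.finrank_eq_card_basis e, Fintype.card_fin]
  obtain ⟨a, v, hdvd, hv, hdet⟩ := (M.galoisCompatible hP).exists_coherent e
  -- The `p`-adic limit of the coherent integers `a k j r`.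
  let A' (r : Fin n) (j : Fin m) : ℤ_[p] :=
    PadicInt.ofIntSeq _ (PadicInt.isCauSeq_padicNorm_of_pow_dvd_sub (fun k => a k j r) p
      fun k => hdvd k j r)
  have hA' : ∀ r j k, PadicInt.toZModPow k (A' r j) = a k j r := fun r j k =>
    PadicInt.toZModPow_ofIntSeq_of_pow_dvd_sub (fun k => a k j r) p (fun k => hdvd k j r) k
  refine ⟨fun r => Matrix.diagonal (A' r), fun e' =>
    ⟨fun r => Matrix.isDiag_diagonal _, ?_⟩⟩
  -- the change of basis is compensated by a power of `p`
  set d : SegRing K M.J := e.det e' with hd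
  obtain ⟨N, hN⟩ := pow_unbounded_of_one_lt (segNorm d) hp1
  set c : K := ((p : K) ^ N)⁻¹ with hc
  have hcn : ‖c‖ = (p : ℝ) ^ N := by rw [hc, norm_inv, norm_pow, hp, inv_pow, inv_inv]
  have hc0 : c ≠ 0 := norm_ne_zero_iff.1 (by rw [hcn]; positivity)
  -- `p^t` absorbs the rescaling and the change of basis. In the final constant `t + n + l`, `n`
  -- comes from the averaging and `l` from the action; `k ≥ 1` allows `t` to be replaced by `t * k`.
  obtain ⟨t, ht⟩ := pow_unbounded_of_one_lt
    ((p : ℝ) ^ N * ∑ i, ∑ s, segNorm (e'.repr (e s) i)) hp1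
  refine ⟨fun k => c • e'.toMatrix (v k), fun k _ ζ hζ j => ?_, ⟨t + n + l, by positivity,
    fun k hk i j => ?_⟩, fun k _ => ?_⟩
  · have hS : ∑ i, (c • e'.toMatrix (v k)) i j • e' i = c • v k j := by
      conv_rhs => rw [← e'.sum_repr (v k j), Finset.smul_sum]
      exact Finset.sum_congr rfl fun i _ => smul_assoc c (e'.repr (v k j) i) (e' i)
    have hsc : ∀ x : KGam K p, (c • v k j) ⊗ₜ[K] x =
        scal K (KGam K p) M.P'.carrier (algebraMap K _ c * x) (v k j ⊗ₜ[K] 1) := fun x => by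
      rw [scal_tmul, TensorProduct.smul_tmul, mul_one, Algebra.smul_def]
    have hχ : Gam.val (∏ r, Gam.padicPow (ζ r) (Matrix.diagonal (A' r) j j)) =
        Gam.char ζ (a k j) := by
      rw [Gam.char]
      congr 1
      refine Finset.prod_congr rfl fun r _ => ?_
      rw [Matrix.diagonal_apply_eq]
      exact Gam.padicPow_eq_zpow (hζ r) (hA' r j k)
    rw [hS, hχ, hsc, hsc, mul_one, M.P'.act_scal, map_mul, Module.End.mul_apply, hv,
      M.P'.act_proj _ _ (Gam.mem_level.2 hζ)]
  · have h1 : e'.repr (v k j) i = ∑ s, e'.repr (e s) i * e.repr (v k j) s :=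
      (congrFun (congrFun (e'.toMatrix_mul_toMatrix e (v k)) i) j).symm
    have h2 : ∀ s, segNorm (e.repr (v k j) s) ≤ (p : ℝ) ^ (k * n) * (p : ℝ) ^ (l * k) :=
      fun s => segNorm_repr_le hp e (hE k hk) (by positivity) (hv k j) s
    have hpos : (0 : ℝ) ≤ (p : ℝ) ^ (k * n) * (p : ℝ) ^ (l * k) := by positivity
    have hC : ∀ s, segNorm (e'.repr (e s) i) ≤ ∑ i, ∑ s, segNorm (e'.repr (e s) i) := fun s =>
      (Finset.single_le_sum (f := fun s => segNorm (e'.repr (e s) i))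
        (fun s _ => segNorm_nonneg _) (Finset.mem_univ s)).trans
      (Finset.single_le_sum (f := fun i => ∑ s, segNorm (e'.repr (e s) i))
        (fun i _ => Finset.sum_nonneg fun s _ => segNorm_nonneg _) (Finset.mem_univ i))
    set C := ∑ i, ∑ s, segNorm (e'.repr (e s) i)
    have hC0 : 0 ≤ C := Finset.sum_nonneg fun i _ => Finset.sum_nonneg fun s _ => segNorm_nonneg _
    have h3 : segNorm (e'.repr (v k j) i) ≤ C * ((p : ℝ) ^ (k * n) * (p : ℝ) ^ (l * k)) := by
      rw [h1]
      exact segNorm_sum_le _ _ (mul_nonneg hC0 hpos) fun s _ => (segNorm_mul_le _ _).trans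
        (mul_le_mul (hC s) (h2 s) (segNorm_nonneg _) hC0)
    have hk1 : (1 : ℝ) ≤ k := by exact_mod_cast hk
    calc segNorm ((c • e'.toMatrix (v k)) i j)
        ≤ ‖c‖ * segNorm (e'.repr (v k j) i) := segNorm_smul_le c _
      _ ≤ (p : ℝ) ^ N * (C * ((p : ℝ) ^ (k * n) * (p : ℝ) ^ (l * k))) := by
        rw [hcn]; gcongr
      _ ≤ (p : ℝ) ^ t * ((p : ℝ) ^ (k * n) * (p : ℝ) ^ (l * k)) := by
        rw [← mul_assoc]; gcongr
      _ = (p : ℝ) ^ ((t : ℝ) + ((k * n : ℕ) : ℝ) + l * k) := by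
        rw [Real.rpow_add hp0, Real.rpow_add hp0, Real.rpow_natCast, Real.rpow_natCast, mul_assoc]
      _ ≤ (p : ℝ) ^ ((t + n + l) * k) := by
        refine Real.rpow_le_rpow_of_exponent_le hp1.le ?_
        push_cast
        nlinarith [(Nat.cast_nonneg t : (0 : ℝ) ≤ t)]
  -- Rank 0 is separate because the rescaling multiplies the determinant by `c ^ m`, which has norm
  -- at least `p^N` only for `m ≥ 1`.
  · rcases Nat.eq_zero_or_pos m with hm0 | hm0
    · subst hm0
      rw [Matrix.det_isEmpty]
      exact one_le_segNorm_one
    have h1 : e.det (v k) = d * e'.det (v k) := by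
      conv_lhs => rw [e.det.eq_smul_basis_det e']
      rfl
    -- Submultiplicativity bounds the new determinant below by the inverse of `segNorm d`, and `p^N`
    -- exceeds `segNorm d`.
    have h2 : 1 ≤ segNorm d * segNorm (e'.det (v k)) :=
      (hdet k).trans (h1 ▸ segNorm_mul_le _ _)
    have h3 : (c • e'.toMatrix (v k)).det = c ^ m • e'.det (v k) := by
      rw [Matrix.det_smul_of_tower, Fintype.card_fin, e'.det_apply]
    rw [h3]
    refine le_trans ?_ (norm_mul_segNorm_le (pow_ne_zero m hc0) _)
    rw [norm_pow, hcn]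
    refine h2.trans (mul_le_mul_of_nonneg_right (hN.le.trans ?_) (segNorm_nonneg _))
    exact le_self_pow₀ (one_le_pow₀ hp1.le) hm0.ne'

end Existence

end PAdicFuchs

end

theorem mainTheorem6 (p : ℕ) [Fact p.Prime] (K : Type*) [NontriviallyNormedField K]
    [CompleteSpace K] [IsUltrametricDist K] (hp : ‖(p : K)‖ = (p : ℝ)⁻¹)
    (n : ℕ) (ρ : PAdicFuchs.Radii n) (P : PAdicFuchs.Crho K p ρ)
    (m : ℕ) (hm : Module.finrank (PAdicFuchs.GermRing K ρ) P.carrier = m) :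
    (∃ A : Fin n → Matrix (Fin m) (Fin m) ℤ_[p], P.IsExponent A) ∧
    ∀ M : PAdicFuchs.Model P.toGammaModule,
      ∃ A : Fin n → Matrix (Fin m) (Fin m) ℤ_[p],
        ∀ e : Module.Basis (Fin m) (PAdicFuchs.SegRing K M.J) M.P'.carrier,
          M.IsExponent e A := by
  have key : ∀ M : PAdicFuchs.Model P.toGammaModule, _ := fun M =>
    M.exists_exponent hp P.galois hm
  refine ⟨?_, key⟩
  obtain ⟨M⟩ := P.exists_model
  obtain ⟨A, hA⟩ := key M
  let e := Module.finBasisOfFinrankEq (PAdicFuchs.SegRing K M.J) M.P'.carrier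
    (M.finrank_eq.symm.trans hm)
  exact ⟨A, M, e, hA e⟩
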